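/- **Conventions.** Points of $\{0,1\}^n$ are identified with subsets of $U=\{1,\dots,n\}$, ordered by inclusion, and a function $f:\{0,1\}^n\to R$ into a totally ordered set $R$ is *monotone* if $S\subseteq S'$ implies $f(S)\le f(S')$. It is *$\varepsilon$-far from monotone* if every monotone $g:\{0,1\}^n\to R$ differs from $f$ in at least $\varepsilon 2^n$ points. A *(randomized, adaptive) monotonicity tester with two-sided error $\delta$* for $\varepsilon$ and $R$ is a random choice of a deterministic adaptive algorithm which queries values of an unknown function $f:\{0,1\}^n\to R$, each query depending on the previous answers, and then accepts or rejects; it rejects each monotone $f$ with probability at most $\delta$ and accepts each $f$ that is $\varepsilon$-far from monotone with probability at most $\delta$. Its query complexity is the maximum number of queries over all $f$ and all coin outcomes. For $A,B\subseteq U$ let $$h_{AB}:2^U\to\mathbb Z,\qquad h_{AB}(S)=2|S|+(-1)^{|S\cap A|}+(-1)^{|S\cap B|}.$$ **Theorem.** 1. For every $\kappa>0$ there is $c>0$ such that, for every $n\ge 0$ and every totally ordered set $R$ with $|R|\ge\max(2,\kappa n)$ ($R$ may be infinite), every adaptive monotonicity tester for functions $\{0,1\}^n\to R$ with $\varepsilon=\tfrac18$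 and two-sided error $\tfrac13$ that makes at most $q$ queries has $q\ge cn$. 2. For all $n$ and $A,B\subseteq U$: if $A\cap B=\emptyset$, then $h_{AB}$ is monotone; if $|A\cap B|=1$, then $h_{AB}$ is $\tfrac18$-far from monotone. 3. Let $R$ be a totally ordered set and let $\varphi:\mathbb Z\to R$ be strictly increasing on the set of all values $h_{AB}(S)$, $A,B,S\subseteq U$. If there is a monotonicity tester for functions $\{0,1\}^n\to R$ with $\varepsilon=\tfrac18$, two-sided error $\delta$ and at most $q$ queries, then there is a public-coin randomized two-party protocol, using the same coins as the tester and exchanging at most $2q$ bits for all inputs and coin outcomes, which solves unique-disjointness with two-sided error $\delta$: on inputs $A\subseteq U$ (Alice) and $B\subseteq U$ (Bob), it outputs "disjoint" with probability at least $1-\delta$ if $A\cap B=\emptyset$, and "not disjoint" with probability at least $1-\delta$ if $|A\cap B|=1$. -/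

import Mathlib

open MeasureTheory

namespace PropertyTesting

universe u v w

section Testers

variable {D : Type u} {R : Type v} {Ω : Type w}

/-- `f` is `ε`-far from the property `P`: every `g ∈ P` differs from `f` in at least `ε * |D|`
entries. -/
def IsFar [Fintype D] [DecidableEq R] (ε : ℝ) (P : Set (D → R)) (f : D → R) : Prop :=
  ∀ g ∈ P, ε * (Fintype.card D : ℝ) ≤ (hammingDist f g : ℝ)

/-- A deterministic adaptive query algorithm with black-box access to a function `D → R`:
it either halts and declares (`true` for "in the property", `false` for "far from the property"),
or asks for the value at a point and continues in a way that depends on the answer. -/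
inductive QueryAlg (D : Type u) (R : Type v) : Type (max u v)
  | declare (accept : Bool) : QueryAlg D R
  | query (x : D) (next : R → QueryAlg D R) : QueryAlg D R

/-- The declaration made when the algorithm is run on the unknown function `f`. -/
def QueryAlg.verdict : QueryAlg D R → (D → R) → Bool
  | .declare b, _ => b
  | .query x next, f => (next (f x)).verdict f

/-- The number of queries made when the algorithm is run on the unknown function `f`. -/
def QueryAlg.numQueries : QueryAlg D R → (D → R) → ℕ
  | .declare _, _ => 0
  | .query x next, f => (next (f x)).numQueries f + 1

/-- A randomized adaptive algorithm draws its coins `ω` from the probability space `(Ω, μ)` and then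
runs the deterministic adaptive algorithm `T ω`. It is a tester for `P` with proximity parameter `ε`
and two-sided error `δ` if it accepts each `f ∈ P`, and rejects each `f` that is `ε`-far from `P`,
except with probability at most `δ`; on all other functions any behaviour is allowed. -/
structure IsTester [Fintype D] [DecidableEq R] [MeasurableSpace Ω] (ε δ : ℝ) (P : Set (D → R))
    (μ : Measure Ω) (T : Ω → QueryAlg D R) : Prop where
  measurableSet_accept : ∀ f : D → R, MeasurableSet {ω | (T ω).verdict f = true}
  error_of_mem : ∀ f ∈ P, μ.real {ω | (T ω).verdict f = false} ≤ δ
  error_of_far : ∀ f, IsFar ε P f → μ.real {ω | (T ω).verdict f = true} ≤ δ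

/-- For every input function and every outcome of its coins, the randomized algorithm makes at most
`q` queries. -/
def MakesAtMost (T : Ω → QueryAlg D R) (q : ℕ) : Prop :=
  ∀ (f : D → R) (ω : Ω), (T ω).numQueries f ≤ q

end Testers

/-- The property of being monotone, for functions from the cube `{0,1}ⁿ` to an ordered set; points
of the cube are identified with subsets of an `n`-element set, so that the coordinatewise order is
inclusion. -/
def monotoneProperty (n : ℕ) (R : Type u) [Preorder R] : Set (Finset (Fin n) → R) :=
  {f | Monotone f}

/-- `h_{AB}(S) = 2|S| + (-1)^{|S ∩ A|} + (-1)^{|S ∩ B|}`. -/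
def hAB {n : ℕ} (A B S : Finset (Fin n)) : ℤ :=
  2 * (S.card : ℤ) + (-1) ^ (S ∩ A).card + (-1) ^ (S ∩ B).card

section Communication

variable {X : Type u} {Y : Type v} {Ω : Type w}

/-- A deterministic two-party protocol with a Boolean output: at each step, whose turn it is depends
on the bits exchanged so far only, and that party sends one bit, a function of the party's own input
and of the bits exchanged so far. -/
inductive Protocol (X : Type u) (Y : Type v) : Type (max u v)
  | output (b : Bool) : Protocol X Y
  | alice (msg : X → Bool) (next : Bool → Protocol X Y) : Protocol X Y
  | bob (msg : Y → Bool) (next : Bool → Protocol X Y) : Protocol X Y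

/-- The output of a protocol on the input pair `(x, y)`. -/
def Protocol.run : Protocol X Y → X → Y → Bool
  | .output b, _, _ => b
  | .alice msg next, x, y => (next (msg x)).run x y
  | .bob msg next, x, y => (next (msg y)).run x y

/-- The number of bits exchanged on the input pair `(x, y)`. -/
def Protocol.cost : Protocol X Y → X → Y → ℕ
  | .output _, _, _ => 0
  | .alice msg next, x, y => (next (msg x)).cost x y + 1
  | .bob msg next, x, y => (next (msg y)).cost x y + 1

/-- The public-coin randomized protocol that draws the coins `ω` from `(Ω, μ)` and runs `Pr ω` solves
unique-disjointness with two-sided error `δ`: it outputs `true` ("disjoint") if `A ∩ B = ∅`, and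
`false` ("not disjoint") if `|A ∩ B| = 1`, except with probability at most `δ`. -/
structure SolvesUniqueDisjointness [MeasurableSpace Ω] {n : ℕ} (δ : ℝ) (μ : Measure Ω)
    (Pr : Ω → Protocol (Finset (Fin n)) (Finset (Fin n))) : Prop where
  measurableSet_output : ∀ A B, MeasurableSet {ω | (Pr ω).run A B = true}
  error_of_disjoint : ∀ A B, A ∩ B = ∅ → μ.real {ω | (Pr ω).run A B = false} ≤ δ
  error_of_unique : ∀ A B, (A ∩ B).card = 1 → μ.real {ω | (Pr ω).run A B = true} ≤ δ

/-- For every pair of inputs and every outcome of the coins, the protocol exchanges at most `k`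
bits. -/
def CostAtMost (Pr : Ω → Protocol X Y) (k : ℕ) : Prop :=
  ∀ (x : X) (y : Y) (ω : Ω), (Pr ω).cost x y ≤ k

end Communication

end PropertyTesting

open PropertyTesting

/-! ### Disjoint versus uniquely intersecting pairs in a rectangle. -/

section RectangleBound

/-! A tester run on `h_{AB}` can be simulated by two players: each queried value is determined by
the public set and by two parities, one known to each player, so a query costs two bits. Adding `i`
to a set raises `2|S|` by 2, while a sign drops by at most 2. If `A` and `B` are disjoint, at most
one sign changes; at a common element both can drop, which creates many decreasing edges. Testing
thus inherits the linear lower bound for unique-disjointness (`exists_protocol_of_tester`,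
`uniqueDisjointness_cost_ge`).

The communication bound is of corruption type. Disjoint pairs are generated from a partition `(z,
zᶜ)` by choosing a subset of each side; uniquely intersecting pairs arise by giving one element to
both sides. In a rectangle, a coordinate balanced on both sides is present in a constant fraction of
the sets on each side, so the intersecting weight is comparable to the disjoint weight there. Many
unbalanced coordinates force exponentially small density (`subsetSum_le_of_unbalanced`). This gives
`rectangle_bound`, up to an exponentially small error. A protocol with `k` bits splits the inputs
into at most `2 ^ k` rectangles. Taking fifth powers of the acceptance probability separates the two
cases by enough to overcome the constants, so `2 ^ (5k)` must be exponential in `n`.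

For a range smaller than the set of values of `h_{AB}`, the same argument runs inside a set `M` of
`m` coordinates, where only `m + 3` values occur. -/

/-- The sum of `f` over the subsets of `z`. -/
noncomputable def subsetSum {ι : Type*} (f : Finset ι → ℝ) (z : Finset ι) : ℝ :=
  ∑ a ∈ z.powerset, f a

/-- The sum of `f` over the subsets of `z` that contain `i`. -/
noncomputable def subsetSumMem {ι : Type*} [DecidableEq ι] (f : Finset ι → ℝ) (z : Finset ι)
    (i : ι) : ℝ :=
  ∑ a ∈ z.powerset, if i ∈ a then f a else 0

/-- The elements of `z` that are contained in less than a quarter or in more than three quarters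
of the subsets of `z`, weighted by `f`. -/
noncomputable def unbalanced {ι : Type*} [DecidableEq ι] (f : Finset ι → ℝ) (z : Finset ι) :
    Finset ι :=
  z.filter fun i => 4 * subsetSumMem f z i < subsetSum f z ∨
    3 * subsetSum f z < 4 * subsetSumMem f z i

/-- The exponential rate at which unbalanced elements decrease the density of a family. -/
noncomputable def unbalancedRate : ℝ := Real.log (27 / 16) / 4

lemma unbalancedRate_pos : 0 < unbalancedRate := by
  unfold unbalancedRate
  have := Real.log_pos (show (1 : ℝ) < 27 / 16 by norm_num)
  linarith

lemma subsetSum_nonneg {ι : Type*} {f : Finset ι → ℝ} (hf : ∀ a, 0 ≤ f a) (z : Finset ι) :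
    0 ≤ subsetSum f z := Finset.sum_nonneg fun a _ => hf a

lemma subsetSum_one {ι : Type*} (z : Finset ι) : subsetSum (fun _ => 1) z = 2 ^ z.card := by
  simp [subsetSum]

variable {ι : Type*} [DecidableEq ι]

lemma subsetSumMem_nonneg {f : Finset ι → ℝ} (hf : ∀ a, 0 ≤ f a) (z : Finset ι) (i : ι) :
    0 ≤ subsetSumMem f z i := Finset.sum_nonneg fun a _ => by split_ifs <;> simp [hf a]

lemma subsetSum_insert (f : Finset ι → ℝ) {z : Finset ι} {i : ι} (hi : i ∉ z) :
    subsetSum f (insert i z) = subsetSum f z + subsetSumMem f (insert i z) i := by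
  unfold subsetSum subsetSumMem
  rw [Finset.sum_powerset_insert hi, Finset.sum_powerset_insert hi]
  congr 1
  have h : ∀ a ∈ z.powerset, (if i ∈ a then f a else 0) = 0 := fun a ha =>
    if_neg fun h => hi (Finset.mem_powerset.1 ha h)
  rw [Finset.sum_eq_zero h, zero_add]
  exact Finset.sum_congr rfl fun a _ => by simp

/-- The `f`-weighted total of an additive statistic, in which each element contributes `x i` if it is
present and `y i` if it is absent, can be computed elementwise. -/
lemma sum_mul_additive (f : Finset ι → ℝ) (z : Finset ι) (x y : ι → ℝ) :
    ∑ a ∈ z.powerset, f a * (∑ i ∈ a, x i + ∑ i ∈ z \ a, y i) =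
      ∑ i ∈ z, (x i * subsetSumMem f z i + y i * (subsetSum f z - subsetSumMem f z i)) := by
  have h : ∀ a ∈ z.powerset, f a * (∑ i ∈ a, x i + ∑ i ∈ z \ a, y i) =
      ∑ i ∈ z, (x i * (if i ∈ a then f a else 0) + y i * (f a - if i ∈ a then f a else 0)) := by
    intro a ha
    have ha := Finset.mem_powerset.1 ha
    rw [← Finset.sum_sdiff ha, add_comm, mul_add, Finset.mul_sum, Finset.mul_sum]
    congr 1
    · refine Finset.sum_congr rfl fun i hi => ?_
      simp [(Finset.mem_sdiff.1 hi).2, mul_comm]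
    · refine Finset.sum_congr rfl fun i hi => ?_
      simp [hi, mul_comm]
  rw [Finset.sum_congr rfl h, Finset.sum_comm]
  refine Finset.sum_congr rfl fun i _ => ?_
  rw [Finset.sum_add_distrib, ← Finset.mul_sum, ← Finset.mul_sum, Finset.sum_sub_distrib]
  rfl

/-- A family of subsets of `z` with many unbalanced elements is exponentially sparse. -/
theorem subsetSum_le_of_unbalanced {f : Finset ι → ℝ} (hf : ∀ a, 0 ≤ f a) (hf1 : ∀ a, f a ≤ 1)
    (z : Finset ι) :
    subsetSum f z ≤ 2 ^ z.card * Real.exp (-(unbalancedRate * (unbalanced f z).card)) := by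
  set t := subsetSum f z with ht
  set p := subsetSumMem f z with hp
  set l := unbalancedRate * (unbalanced f z).card with hl
  -- Tilt the uniform measure by a product density: factor `u i` if `i` is present and `2 - u i` if
  -- it is absent, biased towards the majority at each unbalanced `i`. The logarithm of the density
  -- is `s`.
  let u : ι → ℝ := fun i => if 4 * p i < t then 1 / 2 else if 3 * t < 4 * p i then 3 / 2 else 1
  have hu : ∀ i, 0 < u i := fun i => by simp only [u]; split_ifs <;> norm_num
  have hv : ∀ i, 0 < 2 - u i := fun i => by simp only [u]; split_ifs <;> norm_num
  let s : Finset ι → ℝ := fun a => ∑ i ∈ a, Real.log (u i) + ∑ i ∈ z \ a, Real.log (2 - u i)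
  have hexp : ∑ a ∈ z.powerset, Real.exp (s a) = 2 ^ z.card := by
    have h := Finset.prod_add u (fun i => 2 - u i) z
    simp only [add_sub_cancel, Finset.prod_const] at h
    rw [h]
    refine Finset.sum_congr rfl fun a _ => ?_
    simp only [s]
    rw [Real.exp_add, Real.exp_sum, Real.exp_sum]
    simp only [Real.exp_log (hu _), Real.exp_log (hv _)]
  -- Balanced elements contribute 0, as `log 1 = 0`. At an unbalanced element the majority has
  -- weight at least `3t/4`, so the contribution is at least `t * (3 log (3/2) + log (1/2)) / 4`.
  have hmean : l * t ≤ ∑ a ∈ z.powerset, f a * s a := by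
    simp only [s]
    rw [sum_mul_additive, hl, mul_comm _ ((unbalanced f z).card : ℝ), mul_assoc, ← nsmul_eq_mul,
      ← Finset.sum_const, unbalanced, Finset.sum_filter]
    refine Finset.sum_le_sum fun i _ => ?_
    have h3 : unbalancedRate = (3 * Real.log (3 / 2) + Real.log (1 / 2)) / 4 := by
      have h : Real.log ((3 / 2) ^ 3 * (1 / 2)) = 3 * Real.log (3 / 2) + Real.log (1 / 2) := by
        rw [Real.log_mul (by norm_num) (by norm_num), Real.log_pow]; norm_num
      rw [unbalancedRate, ← h]; norm_num
    have h1 : 0 < Real.log (3 / 2) := Real.log_pos (by norm_num)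
    have h2 : Real.log (1 / 2) < 0 := Real.log_neg (by norm_num) (by norm_num)
    change (if 4 * p i < t ∨ 3 * t < 4 * p i then unbalancedRate * t else 0) ≤
      Real.log (u i) * p i + Real.log (2 - u i) * (t - p i)
    rw [h3]
    by_cases c1 : 4 * p i < t
    · simp only [u, c1, true_or, if_true]
      norm_num only
      nlinarith
    · by_cases c2 : 3 * t < 4 * p i
      · simp only [u, c1, c2, or_true, if_true, if_false]
        norm_num only
        nlinarith
      · simp only [u, c1, c2, or_self, if_false]
        norm_num
  -- Jensen's inequality in tangent-line form: `exp (s a)` lies above the tangent of `exp` at `l`,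
  -- and the `f`-average of `s` is at least `l`.
  have hkey : Real.exp l * t ≤ 2 ^ z.card := by
    calc Real.exp l * t ≤ Real.exp l * (t + (∑ a ∈ z.powerset, f a * s a - l * t)) := by
          have := Real.exp_pos l
          apply mul_le_mul_of_nonneg_left _ this.le
          linarith
      _ = ∑ a ∈ z.powerset, f a * (Real.exp l * (s a - l + 1)) := by
          rw [ht, subsetSum, Finset.mul_sum, ← Finset.sum_sub_distrib, ← Finset.sum_add_distrib,
            Finset.mul_sum]
          exact Finset.sum_congr rfl fun a _ => by ring
      _ ≤ ∑ a ∈ z.powerset, Real.exp (s a) := by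
          refine Finset.sum_le_sum fun a _ => ?_
          have h1 : Real.exp l * (s a - l + 1) ≤ Real.exp (s a) := by
            have h := Real.add_one_le_exp (s a - l)
            calc _ ≤ Real.exp l * Real.exp (s a - l) :=
                  mul_le_mul_of_nonneg_left h (Real.exp_pos l).le
              _ = _ := by rw [← Real.exp_add]; ring_nf
          have h2 := Real.exp_pos (s a)
          nlinarith [hf a, hf1 a, mul_le_mul_of_nonneg_left h1 (hf a)]
      _ = _ := hexp
  rw [Real.exp_neg, ← div_eq_mul_inv, le_div_iff₀ (Real.exp_pos l), mul_comm]
  exact hkey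

/-- The comparison, at a single coordinate, of the pairs that do not both contain it with those that
do. -/
lemma coordinate_bound {p₀ p₁ g₀ g₁ : ℝ} (hp₀ : 0 ≤ p₀) (hp₁ : 0 ≤ p₁) (hg₀ : 0 ≤ g₀)
    (hg₁ : 0 ≤ g₁) :
    (p₀ + p₁) * g₀ + p₀ * (g₀ + g₁) ≤ 24 * (p₁ * g₁) +
      5 * ((if 4 * p₁ < p₀ + p₁ ∨ 3 * (p₀ + p₁) < 4 * p₁ then (p₀ + p₁) * g₀ else 0) +
        if 4 * g₁ < g₀ + g₁ ∨ 3 * (g₀ + g₁) < 4 * g₁ then p₀ * (g₀ + g₁) else 0) := by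
  have h00 := mul_nonneg hp₀ hg₀
  have h01 := mul_nonneg hp₀ hg₁
  have h10 := mul_nonneg hp₁ hg₀
  have h11 := mul_nonneg hp₁ hg₁
  -- If both sides are balanced, `p₀ ≤ 3 p₁` and `g₀ ≤ 3 g₁` bound the left side by `(18 + 3 + 3) p₁
  -- g₁`. If just one is unbalanced, balance of the other bounds the product without an indicator by
  -- 4 times the product with one, hence the 5.
  split_ifs with c d d
  · nlinarith
  · have : g₁ ≤ 3 * g₀ := by by_contra! h; exact d (Or.inr (by linarith))
    nlinarith [mul_le_mul_of_nonneg_left this hp₀]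
  · have : p₁ ≤ 3 * p₀ := by by_contra! h; exact c (Or.inr (by linarith))
    nlinarith [mul_le_mul_of_nonneg_right this hg₀]
  · have h1 : p₀ ≤ 3 * p₁ := by by_contra! h; exact c (Or.inl (by linarith))
    have h2 : g₀ ≤ 3 * g₁ := by by_contra! h; exact d (Or.inl (by linarith))
    nlinarith [mul_le_mul_of_nonneg_right h1 hg₀, mul_le_mul_of_nonneg_left h2 hp₁,
      mul_le_mul_of_nonneg_right h1 hg₁]

lemma subsetSumMem_one {z : Finset ι} {i : ι} (hi : i ∉ z) :
    subsetSumMem (fun _ => 1) (insert i z) i = 2 ^ z.card := by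
  have h := subsetSum_insert (fun _ => (1 : ℝ)) hi
  rw [subsetSum_one, subsetSum_one, Finset.card_insert_of_notMem hi, pow_succ] at h
  linarith

variable [Fintype ι]

lemma sum_finset_eq_sum_notMem (i : ι) (F : Finset ι → ℝ) :
    ∑ z, F z = ∑ z with i ∉ z, (F (insert i z) + F z) := by
  rw [← Finset.sum_filter_not_add_sum_filter Finset.univ (fun z : Finset ι => i ∉ z) F,
    Finset.sum_add_distrib]
  congr 1
  refine Finset.sum_bij' (fun z _ => z.erase i) (fun z _ => insert i z) ?_ ?_ ?_ ?_ ?_ <;>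
    simp +contextual [Finset.insert_erase]

/-- The number of unbalanced elements on either side of the partition `(z, zᶜ)`. -/
noncomputable def unbalancedCount (f g : Finset ι → ℝ) (z : Finset ι) : ℝ :=
  (unbalanced f z).card + (unbalanced g zᶜ).card

lemma unbalancedCount_le (f g : Finset ι → ℝ) (z : Finset ι) :
    unbalancedCount f g z ≤ Fintype.card ι := by
  have h1 : (unbalanced f z).card ≤ z.card := Finset.card_filter_le _ _
  have h2 : (unbalanced g zᶜ).card ≤ zᶜ.card := Finset.card_filter_le _ _
  have h3 := Finset.card_add_card_compl z
  unfold unbalancedCount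
  exact_mod_cast (by omega : (unbalanced f z).card + (unbalanced g zᶜ).card ≤ Fintype.card ι)

/-- A partition with at most `n / 10` unbalanced elements falls under the first term. Any other has
exponentially small mass, and its count is at most `n`; summing over the `2 ^ n` partitions gives
the second term. The threshold `n / 10` makes the factor 5 of `card_mul_sum_le` cost only half of
the main term. -/
lemma sum_unbalancedCount_le {f g : Finset ι → ℝ} (hf : ∀ a, 0 ≤ f a) (hf1 : ∀ a, f a ≤ 1)
    (hg : ∀ a, 0 ≤ g a) (hg1 : ∀ a, g a ≤ 1) :
    ∑ z, subsetSum f z * subsetSum g zᶜ * unbalancedCount f g z ≤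
      (Fintype.card ι : ℝ) / 10 * ∑ z, subsetSum f z * subsetSum g zᶜ +
        Fintype.card ι * 4 ^ Fintype.card ι *
          Real.exp (-(unbalancedRate * (Fintype.card ι / 10))) := by
  set n := Fintype.card ι with hn
  have hterm : ∀ z : Finset ι, subsetSum f z * subsetSum g zᶜ * unbalancedCount f g z ≤
      (n : ℝ) / 10 * (subsetSum f z * subsetSum g zᶜ) +
        n * 2 ^ n * Real.exp (-(unbalancedRate * (n / 10))) := by
    intro z
    have hfz := subsetSum_nonneg hf z
    have hgz := subsetSum_nonneg hg zᶜ
    have hfg := mul_nonneg hfz hgz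
    by_cases h : unbalancedCount f g z ≤ n / 10
    · have : 0 ≤ n * 2 ^ n * Real.exp (-(unbalancedRate * (n / 10))) := by positivity
      nlinarith [mul_le_mul_of_nonneg_left h hfg]
    · push Not at h
      have h1 : subsetSum f z * subsetSum g zᶜ ≤
          2 ^ n * Real.exp (-(unbalancedRate * (n / 10))) := by
        calc _ ≤ (2 ^ z.card * Real.exp (-(unbalancedRate * (unbalanced f z).card))) *
              (2 ^ zᶜ.card * Real.exp (-(unbalancedRate * (unbalanced g zᶜ).card))) :=
              mul_le_mul (subsetSum_le_of_unbalanced hf hf1 z)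
                (subsetSum_le_of_unbalanced hg hg1 zᶜ) hgz (by positivity)
          _ = 2 ^ n * Real.exp (-(unbalancedRate * unbalancedCount f g z)) := by
              rw [hn, ← Finset.card_add_card_compl z, pow_add, unbalancedCount, mul_add, neg_add,
                Real.exp_add]
              ring
          _ ≤ _ := by
              have := unbalancedRate_pos
              gcongr
      have h2 := unbalancedCount_le f g z
      have h3 : (0 : ℝ) ≤ n := Nat.cast_nonneg n
      have h4 : 0 ≤ (n : ℝ) / 10 * (subsetSum f z * subsetSum g zᶜ) := by positivity
      calc _ ≤ subsetSum f z * subsetSum g zᶜ * n := mul_le_mul_of_nonneg_left h2 hfg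
        _ ≤ 2 ^ n * Real.exp (-(unbalancedRate * (n / 10))) * n :=
            mul_le_mul_of_nonneg_right h1 h3
        _ ≤ _ := by linarith
  refine (Finset.sum_le_sum fun z _ => hterm z).trans_eq ?_
  rw [Finset.sum_add_distrib, ← Finset.mul_sum, Finset.sum_const, Finset.card_univ,
    Fintype.card_finset, nsmul_eq_mul, show (4 : ℝ) = 2 * 2 by norm_num, mul_pow]
  push_cast
  ring

/-- For each `i`, group the partitions into pairs that differ only in the side of `i`, and apply
`coordinate_bound` to each pair; summing over `i` counts every partition `n` times. -/
lemma card_mul_sum_le {f g : Finset ι → ℝ} (hf : ∀ a, 0 ≤ f a) (hg : ∀ a, 0 ≤ g a) :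
    (Fintype.card ι : ℝ) * ∑ z, subsetSum f z * subsetSum g zᶜ ≤
      24 * ∑ i, ∑ z with i ∉ z, subsetSumMem f (insert i z) i * subsetSumMem g zᶜ i +
        5 * ∑ z, subsetSum f z * subsetSum g zᶜ * unbalancedCount f g z := by
  have hcount : ∑ z, subsetSum f z * subsetSum g zᶜ * unbalancedCount f g z =
      ∑ i, ∑ z, ((if i ∈ unbalanced f z then subsetSum f z * subsetSum g zᶜ else 0) +
        if i ∈ unbalanced g zᶜ then subsetSum f z * subsetSum g zᶜ else 0) := by
    rw [Finset.sum_comm]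
    refine Finset.sum_congr rfl fun z _ => ?_
    rw [Finset.sum_add_distrib]
    simp only [Finset.sum_ite_mem, Finset.univ_inter, Finset.sum_const, nsmul_eq_mul,
      unbalancedCount]
    ring
  rw [hcount, ← nsmul_eq_mul, ← Finset.card_univ, ← Finset.sum_const, Finset.mul_sum,
    Finset.mul_sum, ← Finset.sum_add_distrib]
  refine Finset.sum_le_sum fun i _ => ?_
  rw [sum_finset_eq_sum_notMem i, sum_finset_eq_sum_notMem i, Finset.mul_sum, Finset.mul_sum,
    ← Finset.sum_add_distrib]
  refine Finset.sum_le_sum fun z hz => ?_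
  have hz : i ∉ z := (Finset.mem_filter.1 hz).2
  -- The two partitions of a pair are `(insert i z, y)` and `(z, insert i y)`, with `y` the
  -- complement of `insert i z`.
  have hc : zᶜ = insert i (insert i z)ᶜ := by
    ext j; by_cases h : j = i <;> simp [h, hz]
  have hic : i ∉ (insert i z)ᶜ := by simp
  set y := (insert i z)ᶜ with hy
  have e1 : i ∉ unbalanced f z := by simp [unbalanced, hz]
  have e2 : i ∉ unbalanced g y := by simp [unbalanced, hic]
  have e3 : i ∈ unbalanced f (insert i z) ↔
      4 * subsetSumMem f (insert i z) i < subsetSum f z + subsetSumMem f (insert i z) i ∨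
      3 * (subsetSum f z + subsetSumMem f (insert i z) i) < 4 * subsetSumMem f (insert i z) i := by
    rw [← subsetSum_insert f hz]; simp [unbalanced]
  have e4 : i ∈ unbalanced g (insert i y) ↔
      4 * subsetSumMem g (insert i y) i < subsetSum g y + subsetSumMem g (insert i y) i ∨
      3 * (subsetSum g y + subsetSumMem g (insert i y) i) < 4 * subsetSumMem g (insert i y) i := by
    rw [← subsetSum_insert g hic]; simp [unbalanced]
  rw [hc]
  simp only [e1, e2, e3, e4, if_false, add_zero, zero_add]
  rw [subsetSum_insert f hz, subsetSum_insert g hic]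
  exact coordinate_bound (subsetSum_nonneg hf _) (subsetSumMem_nonneg hf _ _)
    (subsetSum_nonneg hg _) (subsetSumMem_nonneg hg _ _)

/-! ### Weights on pairs of sets and the rectangle inequality. -/

/-- The number of partitions `(z, zᶜ)` that are compatible with the pair `(a, b)`; it is a weight
on pairs of disjoint sets. -/
noncomputable def disjointWeight (a b : Finset ι) : ℝ :=
  ∑ z : Finset ι, if a ∈ z.powerset ∧ b ∈ zᶜ.powerset then 1 else 0

/-- A weight on pairs of sets with exactly one common element. -/
noncomputable def uniqueWeight (a b : Finset ι) : ℝ :=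
  ∑ i : ι, ∑ z : Finset ι with i ∉ z,
    if (a ∈ (insert i z).powerset ∧ i ∈ a) ∧ (b ∈ zᶜ.powerset ∧ i ∈ b) then 1 else 0

lemma disjointWeight_nonneg (a b : Finset ι) : 0 ≤ disjointWeight a b :=
  Finset.sum_nonneg fun _ _ => by split_ifs <;> norm_num

lemma uniqueWeight_nonneg (a b : Finset ι) : 0 ≤ uniqueWeight a b :=
  Finset.sum_nonneg fun _ _ => Finset.sum_nonneg fun _ _ => by split_ifs <;> norm_num

lemma disjointWeight_eq_zero {a b : Finset ι} (h : a ∩ b ≠ ∅) : disjointWeight a b = 0 := by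
  refine Finset.sum_eq_zero fun z _ => if_neg ?_
  rintro ⟨ha, hb⟩
  rw [Finset.mem_powerset] at ha hb
  apply h
  rw [← Finset.disjoint_iff_inter_eq_empty]
  exact Finset.disjoint_of_subset_left ha
    (Finset.disjoint_of_subset_right hb disjoint_compl_right)

lemma uniqueWeight_eq_zero {a b : Finset ι} (h : (a ∩ b).card ≠ 1) : uniqueWeight a b = 0 := by
  refine Finset.sum_eq_zero fun i _ => Finset.sum_eq_zero fun z _ => if_neg ?_
  rintro ⟨⟨ha, hia⟩, hb, hib⟩
  rw [Finset.mem_powerset] at ha hb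
  apply h
  rw [Finset.card_eq_one]
  refine ⟨i, Finset.eq_singleton_iff_unique_mem.2 ⟨Finset.mem_inter.2 ⟨hia, hib⟩, ?_⟩⟩
  intro j hj
  obtain ⟨hja, hjb⟩ := Finset.mem_inter.1 hj
  rcases Finset.mem_insert.1 (ha hja) with h | h
  · exact h
  · exact absurd h (Finset.mem_compl.1 (hb hjb))

lemma sum_sum_mul_comm {α β γ : Type*} [Fintype α] [Fintype β] (s : Finset γ)
    (w : γ → α → β → ℝ) (H : α → β → ℝ) :
    ∑ a, ∑ b, (∑ c ∈ s, w c a b) * H a b = ∑ c ∈ s, ∑ a, ∑ b, w c a b * H a b := by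
  rw [Finset.sum_comm (s := s)]
  refine Finset.sum_congr rfl fun a _ => ?_
  rw [Finset.sum_comm (s := s)]
  exact Finset.sum_congr rfl fun b _ => Finset.sum_mul _ _ _

lemma sum_disjointWeight_mul (f g : Finset ι → ℝ) :
    ∑ a, ∑ b, disjointWeight a b * (f a * g b) = ∑ z, subsetSum f z * subsetSum g zᶜ := by
  have h : ∀ z : Finset ι, subsetSum f z * subsetSum g zᶜ =
      ∑ a, ∑ b, (if a ∈ z.powerset ∧ b ∈ zᶜ.powerset then 1 else 0) * (f a * g b) := by
    intro z
    have e : ∀ (f : Finset ι → ℝ) (z : Finset ι),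
        subsetSum f z = ∑ a, if a ∈ z.powerset then f a else 0 := fun f z => by
      rw [Finset.sum_ite_mem, Finset.univ_inter, subsetSum]
    rw [e f z, e g, Finset.sum_mul_sum]
    refine Finset.sum_congr rfl fun a _ => Finset.sum_congr rfl fun b _ => ?_
    by_cases h1 : a ∈ z.powerset <;> by_cases h2 : b ∈ zᶜ.powerset <;> simp only [h1, h2] <;> simp
  simp only [h, disjointWeight]
  exact sum_sum_mul_comm _ _ _

lemma sum_uniqueWeight_mul (f g : Finset ι → ℝ) :
    ∑ a, ∑ b, uniqueWeight a b * (f a * g b) =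
      ∑ i, ∑ z with i ∉ z, subsetSumMem f (insert i z) i * subsetSumMem g zᶜ i := by
  have h : ∀ (i : ι) (z : Finset ι), subsetSumMem f (insert i z) i * subsetSumMem g zᶜ i =
      ∑ a, ∑ b, (if (a ∈ (insert i z).powerset ∧ i ∈ a) ∧ (b ∈ zᶜ.powerset ∧ i ∈ b)
        then 1 else 0) * (f a * g b) := by
    intro i z
    have e : ∀ (f : Finset ι → ℝ) (z : Finset ι),
        subsetSumMem f z i = ∑ a, if a ∈ z.powerset ∧ i ∈ a then f a else 0 := fun f z => by
      simp only [ite_and]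
      rw [Finset.sum_ite_mem, Finset.univ_inter, subsetSumMem]
    rw [e f, e g, Finset.sum_mul_sum]
    refine Finset.sum_congr rfl fun a _ => Finset.sum_congr rfl fun b _ => ?_
    by_cases h1 : a ∈ (insert i z).powerset ∧ i ∈ a <;>
      by_cases h2 : b ∈ zᶜ.powerset ∧ i ∈ b <;> simp only [h1, h2] <;> simp
  simp only [h, uniqueWeight]
  rw [sum_sum_mul_comm]
  exact Finset.sum_congr rfl fun i _ => sum_sum_mul_comm _ _ _

/-- Every rectangle that contains a non-negligible weight of disjoint pairs contains a comparable
weight of pairs with a unique common element. -/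
theorem rectangle_bound {f g : Finset ι → ℝ} (hf : ∀ a, 0 ≤ f a) (hf1 : ∀ a, f a ≤ 1)
    (hg : ∀ a, 0 ≤ g a) (hg1 : ∀ a, g a ≤ 1) :
    -(5 * Fintype.card ι * 4 ^ Fintype.card ι *
        Real.exp (-(unbalancedRate * (Fintype.card ι / 10)))) ≤
      ∑ a, ∑ b, (24 * uniqueWeight a b - Fintype.card ι / 2 * disjointWeight a b) *
        (f a * g b) := by
  have h1 := card_mul_sum_le hf hg
  have h2 := sum_unbalancedCount_le hf hf1 hg hg1
  have h3 : ∑ a, ∑ b, (24 * uniqueWeight a b - Fintype.card ι / 2 * disjointWeight a b) *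
      (f a * g b) = 24 * (∑ a, ∑ b, uniqueWeight a b * (f a * g b)) -
        Fintype.card ι / 2 * ∑ a, ∑ b, disjointWeight a b * (f a * g b) := by
    simp only [Finset.mul_sum, ← Finset.sum_sub_distrib]
    exact Finset.sum_congr rfl fun a _ => Finset.sum_congr rfl fun b _ => by ring
  rw [h3, sum_disjointWeight_mul, sum_uniqueWeight_mul]
  linarith

lemma sum_disjointWeight : ∑ a : Finset ι, ∑ b, disjointWeight a b = 4 ^ Fintype.card ι := by
  have h := sum_disjointWeight_mul (fun _ : Finset ι => (1 : ℝ)) (fun _ => 1)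
  simp only [mul_one] at h
  rw [h]
  simp only [subsetSum_one, ← pow_add, Finset.card_add_card_compl, Finset.sum_const,
    Finset.card_univ, Fintype.card_finset, nsmul_eq_mul]
  push_cast
  rw [← mul_pow]; norm_num

/-- Two partitions that differ in the side of `i` together carry `4 * 2 ^ (|z| + |y|)` pairs, where
`z` and `y` are the sides without `i`; the pairs with `i` in both sets number `2 ^ (|z| + |y|)`. -/
lemma four_mul_sum_uniqueWeight :
    4 * ∑ a : Finset ι, ∑ b, uniqueWeight a b = Fintype.card ι * 4 ^ Fintype.card ι := by
  have h := sum_uniqueWeight_mul (fun _ : Finset ι => (1 : ℝ)) (fun _ => 1)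
  simp only [mul_one] at h
  have h2 := sum_disjointWeight_mul (fun _ : Finset ι => (1 : ℝ)) (fun _ => 1)
  simp only [mul_one] at h2
  rw [h, ← sum_disjointWeight, ← nsmul_eq_mul, ← Finset.card_univ, ← Finset.sum_const,
    Finset.mul_sum]
  refine Finset.sum_congr rfl fun i _ => ?_
  rw [h2, sum_finset_eq_sum_notMem i, Finset.mul_sum]
  refine Finset.sum_congr rfl fun z hz => ?_
  have hz : i ∉ z := (Finset.mem_filter.1 hz).2
  have hc : zᶜ = insert i (insert i z)ᶜ := by
    ext j; by_cases h : j = i <;> simp [h, hz]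
  have hic : i ∉ (insert i z)ᶜ := by simp
  set y := (insert i z)ᶜ with hy
  rw [hc, subsetSumMem_one hz, subsetSumMem_one hic]
  simp only [subsetSum_one, Finset.card_insert_of_notMem hz, Finset.card_insert_of_notMem hic]
  ring

end RectangleBound

/-! ### From rectangles to randomized protocols for unique-disjointness. -/

section ProtocolBound

/-- If the weighted sum of `H` over every rectangle is at least `-ε`, then its weighted sum over the
pairs in a rectangle that are accepted by a protocol of cost at most `k` is at least `-2 ^ k * ε`. -/
lemma protocol_sum_ge {X Y : Type*} [Fintype X] [Fintype Y] {H : X → Y → ℝ} {ε : ℝ} (hε : 0 ≤ ε)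
    (hH : ∀ (P : X → Prop) (Q : Y → Prop) [DecidablePred P] [DecidablePred Q],
      -ε ≤ ∑ x, ∑ y, if P x ∧ Q y then H x y else 0)
    (π : Protocol X Y) (k : ℕ) (P : X → Prop) (Q : Y → Prop) [DecidablePred P] [DecidablePred Q]
    (hk : ∀ x y, P x → Q y → π.cost x y ≤ k) :
    -(2 ^ k * ε) ≤ ∑ x, ∑ y, if P x ∧ Q y then (if π.run x y = true then H x y else 0) else 0 := by
  classical
  have hone : ∀ k : ℕ, ε ≤ 2 ^ k * ε := fun k =>
    le_mul_of_one_le_left hε (one_le_pow₀ (by norm_num))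
  -- On an empty rectangle the cost hypothesis is void, so `k` may be 0 at a node that still sends a
  -- bit; this case is settled before the induction.
  by_cases hempty : ∃ x y, P x ∧ Q y
  swap
  · rw [Finset.sum_eq_zero fun x _ => Finset.sum_eq_zero fun y _ => if_neg fun h =>
      hempty ⟨x, y, h⟩]
    linarith [hone k]
  induction π generalizing k P Q with
  | output b =>
    cases b
    · simp only [Protocol.run, Bool.false_eq_true, if_false, ite_self, Finset.sum_const_zero]
      linarith [hone k]
    · simp only [Protocol.run, if_true]
      linarith [hone k, hH P Q]
  | alice msg next ih =>
    obtain ⟨x₀, y₀, hx₀, hy₀⟩ := hempty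
    obtain _ | k := k
    · exact absurd (hk x₀ y₀ hx₀ hy₀) (by simp [Protocol.cost])
    have key : ∀ c : Bool, -(2 ^ k * ε) ≤ ∑ x, ∑ y, if (P x ∧ msg x = c) ∧ Q y then
        (if (next c).run x y = true then H x y else 0) else 0 := by
      intro c
      by_cases he : ∃ x y, (P x ∧ msg x = c) ∧ Q y
      · refine ih c k (fun x => P x ∧ msg x = c) Q (fun x y hx hy => ?_) he
        have := hk x y hx.1 hy
        simp only [Protocol.cost, hx.2] at this
        omega
      · rw [Finset.sum_eq_zero fun x _ => Finset.sum_eq_zero fun y _ => if_neg fun h =>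
          he ⟨x, y, h⟩]
        linarith [hone k]
    have e : (∑ x, ∑ y, if P x ∧ Q y then
          (if (Protocol.alice msg next).run x y = true then H x y else 0) else 0) =
        (∑ x, ∑ y, if (P x ∧ msg x = true) ∧ Q y then
          (if (next true).run x y = true then H x y else 0) else 0) +
        ∑ x, ∑ y, if (P x ∧ msg x = false) ∧ Q y then
          (if (next false).run x y = true then H x y else 0) else 0 := by
      simp only [← Finset.sum_add_distrib]
      refine Finset.sum_congr rfl fun x _ => Finset.sum_congr rfl fun y _ => ?_
      cases h : msg x <;> simp [Protocol.run, h]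
    rw [e, pow_succ]
    linarith [key true, key false]
  | bob msg next ih =>
    obtain ⟨x₀, y₀, hx₀, hy₀⟩ := hempty
    obtain _ | k := k
    · exact absurd (hk x₀ y₀ hx₀ hy₀) (by simp [Protocol.cost])
    have key : ∀ c : Bool, -(2 ^ k * ε) ≤ ∑ x, ∑ y, if P x ∧ (Q y ∧ msg y = c) then
        (if (next c).run x y = true then H x y else 0) else 0 := by
      intro c
      by_cases he : ∃ x y, P x ∧ (Q y ∧ msg y = c)
      · refine ih c k P (fun y => Q y ∧ msg y = c) (fun x y hx hy => ?_) he
        have := hk x y hx hy.1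
        simp only [Protocol.cost, hy.2] at this
        omega
      · rw [Finset.sum_eq_zero fun x _ => Finset.sum_eq_zero fun y _ => if_neg fun h =>
          he ⟨x, y, h⟩]
        linarith [hone k]
    have e : (∑ x, ∑ y, if P x ∧ Q y then
          (if (Protocol.bob msg next).run x y = true then H x y else 0) else 0) =
        (∑ x, ∑ y, if P x ∧ (Q y ∧ msg y = true) then
          (if (next true).run x y = true then H x y else 0) else 0) +
        ∑ x, ∑ y, if P x ∧ (Q y ∧ msg y = false) then
          (if (next false).run x y = true then H x y else 0) else 0 := by
      simp only [← Finset.sum_add_distrib]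
      refine Finset.sum_congr rfl fun x _ => Finset.sum_congr rfl fun y _ => ?_
      cases h : msg y <;> simp [Protocol.run, h]
    rw [e, pow_succ]
    linarith [key true, key false]

/-- The version of `protocol_sum_ge` for the acceptance probability of a public-coin randomized
protocol. -/
lemma randomized_protocol_sum_ge {X Y Ω : Type*} [Fintype X] [Fintype Y] [MeasurableSpace Ω]
    {μ : Measure Ω} [IsProbabilityMeasure μ] {Pr : Ω → Protocol X Y}
    (hmeas : ∀ x y, MeasurableSet {ω | (Pr ω).run x y = true}) {k : ℕ} (hk : CostAtMost Pr k)
    {H : X → Y → ℝ} {ε : ℝ} (hε : 0 ≤ ε)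
    (hH : ∀ (P : X → Prop) (Q : Y → Prop) [DecidablePred P] [DecidablePred Q],
      -ε ≤ ∑ x, ∑ y, if P x ∧ Q y then H x y else 0)
    (P : X → Prop) (Q : Y → Prop) [DecidablePred P] [DecidablePred Q] :
    -(2 ^ k * ε) ≤ ∑ x, ∑ y, if P x ∧ Q y then
      H x y * μ.real {ω | (Pr ω).run x y = true} else 0 := by
  let F : Ω → X → Y → ℝ := fun ω x y =>
    if P x ∧ Q y then {ω | (Pr ω).run x y = true}.indicator (fun _ => H x y) ω else 0
  have hF : ∀ x y, Integrable (fun ω => F ω x y) μ := by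
    intro x y
    by_cases h : P x ∧ Q y
    · simp only [F, h, and_self, if_true]
      exact (integrable_const _).indicator (hmeas x y)
    · simp only [F, h, if_false]
      exact integrable_zero _ _ _
  have e : (∑ x, ∑ y, if P x ∧ Q y then H x y * μ.real {ω | (Pr ω).run x y = true} else 0) =
      ∫ ω, ∑ x, ∑ y, F ω x y ∂μ := by
    rw [integral_finsetSum _ fun x _ => integrable_finsetSum _ fun y _ => hF x y]
    refine Finset.sum_congr rfl fun x _ => ?_
    rw [integral_finsetSum _ fun y _ => hF x y]
    refine Finset.sum_congr rfl fun y _ => ?_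
    by_cases h : P x ∧ Q y
    · simp only [F, h, and_self, if_true]
      rw [integral_indicator_const _ (hmeas x y), smul_eq_mul, mul_comm]
    · simp [F, h]
  rw [e]
  calc -(2 ^ k * ε) = ∫ _, -(2 ^ k * ε) ∂μ := by simp
    _ ≤ _ := by
      refine integral_mono (integrable_const _)
        (integrable_finsetSum _ fun x _ => integrable_finsetSum _ fun y _ => hF x y) fun ω => ?_
      refine (protocol_sum_ge hε hH (Pr ω) k P Q fun x y _ _ => hk x y ω).trans_eq ?_
      simp only [F, Set.indicator_apply, Set.mem_ofPred_eq]

/-- The version of `randomized_protocol_sum_ge` for the probability that `t` independent runs of the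
protocol all accept. -/
lemma randomized_protocol_pow_sum_ge {X Y Ω : Type*} [Fintype X] [Fintype Y] [MeasurableSpace Ω]
    {μ : Measure Ω} [IsProbabilityMeasure μ] {Pr : Ω → Protocol X Y}
    (hmeas : ∀ x y, MeasurableSet {ω | (Pr ω).run x y = true}) {k : ℕ} (hk : CostAtMost Pr k)
    {H : X → Y → ℝ} {ε : ℝ} (hε : 0 ≤ ε)
    (hH : ∀ (P : X → Prop) (Q : Y → Prop) [DecidablePred P] [DecidablePred Q],
      -ε ≤ ∑ x, ∑ y, if P x ∧ Q y then H x y else 0) (t : ℕ)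
    (P : X → Prop) (Q : Y → Prop) [DecidablePred P] [DecidablePred Q] :
    -((2 ^ k) ^ t * ε) ≤ ∑ x, ∑ y, if P x ∧ Q y then
      H x y * μ.real {ω | (Pr ω).run x y = true} ^ t else 0 := by
  induction t generalizing P Q with
  | zero => simpa using hH P Q
  | succ t ih =>
    -- The weight `H * p ^ t` again satisfies a rectangle bound, by the induction hypothesis, so
    -- each further run costs one factor `2 ^ k` and no product probability space is needed.
    have := randomized_protocol_sum_ge (μ := μ) hmeas hk
      (H := fun x y => H x y * μ.real {ω | (Pr ω).run x y = true} ^ t)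
      (ε := (2 ^ k) ^ t * ε) (by positivity) (fun P Q _ _ => ih P Q) P Q
    simpa only [pow_succ, mul_assoc, mul_comm, mul_left_comm] using this

/-- Every public-coin protocol for unique-disjointness exchanges linearly many bits. -/
theorem uniqueDisjointness_cost_ge {n : ℕ} {Ω : Type*} [MeasurableSpace Ω] {μ : Measure Ω}
    [IsProbabilityMeasure μ] {Pr : Ω → Protocol (Finset (Fin n)) (Finset (Fin n))}
    (hPr : SolvesUniqueDisjointness (1 / 3) μ Pr) {k : ℕ} (hk : CostAtMost Pr k) :
    unbalancedRate / 10 * n - Real.log (243 / 2) ≤ 5 * Real.log 2 * k := by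
  classical
  rcases Nat.eq_zero_or_pos n with rfl | hn
  · have h1 : 0 < Real.log (243 / 2) := Real.log_pos (by norm_num)
    have h2 : 0 < Real.log 2 := Real.log_pos (by norm_num)
    have : 0 ≤ 5 * Real.log 2 * k := by positivity
    simp only [CharP.cast_eq_zero, mul_zero, zero_sub]
    linarith
  set η := Real.exp (-(unbalancedRate * (n / 10))) with hη
  set p : Finset (Fin n) → Finset (Fin n) → ℝ :=
    fun a b => μ.real {ω | (Pr ω).run a b = true} with hp
  have hp0 : ∀ a b, 0 ≤ p a b := fun a b => measureReal_nonneg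
  have hacc : ∀ a b, disjointWeight a b * (2 / 3) ^ 5 ≤ disjointWeight a b * p a b ^ 5 := by
    intro a b
    by_cases h : a ∩ b = ∅
    · have h1 := hPr.error_of_disjoint a b h
      have h2 : {ω | (Pr ω).run a b = false} = {ω | (Pr ω).run a b = true}ᶜ := by
        ext ω; simp
      rw [h2, probReal_compl_eq_one_sub (hPr.measurableSet_output a b)] at h1
      have h3 : 2 / 3 ≤ p a b := by simp only [hp]; linarith
      have := disjointWeight_nonneg a b
      gcongr
    · simp [disjointWeight_eq_zero h]
  have hrej : ∀ a b, uniqueWeight a b * p a b ^ 5 ≤ uniqueWeight a b * (1 / 3) ^ 5 := by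
    intro a b
    by_cases h : (a ∩ b).card = 1
    · have h1 : p a b ≤ 1 / 3 := hPr.error_of_unique a b h
      have := uniqueWeight_nonneg a b
      have := hp0 a b
      gcongr
    · simp [uniqueWeight_eq_zero h]
  -- The total weights `4 ^ n` and `n * 4 ^ n / 4` turn the coefficients `n / 2` and `24` into the
  -- ratio 12, which the fifth power beats: `(2 / 3) ^ 5 = 32 * (1 / 3) ^ 5`.
  have hlow := randomized_protocol_pow_sum_ge (μ := μ) hPr.measurableSet_output hk
    (H := fun a b => 24 * uniqueWeight a b - n / 2 * disjointWeight a b)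
    (ε := 5 * n * 4 ^ n * η) (by positivity) (fun P Q _ _ => by
      have h := rectangle_bound (ι := Fin n) (f := fun a => if P a then 1 else 0)
        (g := fun b => if Q b then 1 else 0) (fun a => by split_ifs <;> norm_num)
        (fun a => by split_ifs <;> norm_num) (fun a => by split_ifs <;> norm_num)
        (fun a => by split_ifs <;> norm_num)
      rw [Fintype.card_fin] at h
      refine h.trans_eq (Finset.sum_congr rfl fun a _ => Finset.sum_congr rfl fun b _ => ?_)
      by_cases h1 : P a <;> by_cases h2 : Q b <;> simp [h1, h2]) 5
    (fun _ => True) (fun _ => True)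
  simp only [and_self, if_true] at hlow
  have hup : ∑ a, ∑ b, (24 * uniqueWeight a b - n / 2 * disjointWeight a b) * p a b ^ 5 ≤
      24 * (1 / 3) ^ 5 * (∑ a : Finset (Fin n), ∑ b, uniqueWeight a b) -
        n / 2 * (2 / 3) ^ 5 * ∑ a : Finset (Fin n), ∑ b, disjointWeight a b := by
    simp only [Finset.mul_sum, ← Finset.sum_sub_distrib]
    refine Finset.sum_le_sum fun a _ => Finset.sum_le_sum fun b _ => ?_
    have hn' : (0 : ℝ) ≤ n / 2 := by positivity
    nlinarith [mul_le_mul_of_nonneg_left (hacc a b) hn', hrej a b]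
  have h4 := four_mul_sum_uniqueWeight (ι := Fin n)
  have h0 := sum_disjointWeight (ι := Fin n)
  rw [Fintype.card_fin] at h4 h0
  rw [h0] at hup
  have hN : (0 : ℝ) < n * 4 ^ n := by positivity
  -- After division by `n * 4 ^ n`, the upper bound is `(6 - 16) / 243` and the lower bound is `-5 *
  -- (2 ^ k) ^ 5 * η`.
  have hmain : (2 / 243 : ℝ) ≤ (2 ^ k) ^ 5 * η := by
    have h5 := hlow.trans hup
    have h6 : (n * 4 ^ n : ℝ) * (2 / 243) ≤ (n * 4 ^ n) * ((2 ^ k) ^ 5 * η) := by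
      linarith
    exact le_of_mul_le_mul_left h6 hN
  have hlog := Real.log_le_log (by norm_num) hmain
  rw [Real.log_mul (by positivity) (Real.exp_pos _).ne', Real.log_exp, Real.log_pow,
    Real.log_pow, show (2 / 243 : ℝ) = (243 / 2)⁻¹ by norm_num, Real.log_inv] at hlog
  push_cast at hlog
  linarith

end ProtocolBound

/-! ### Monotonicity of the functions `h_{AB}` and distance from it. -/

section Functions

variable {n : ℕ}

/-- The analogue of `hAB` that ignores the elements outside of `M`. -/
def restrictedHAB (M A B S : Finset (Fin n)) : ℤ :=
  2 * ((S ∩ M).card : ℤ) + (-1) ^ (S ∩ A).card + (-1) ^ (S ∩ B).card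

lemma restrictedHAB_univ (A B : Finset (Fin n)) : restrictedHAB Finset.univ A B = hAB A B := by
  funext S
  simp [restrictedHAB, hAB]

lemma card_insert_inter {S : Finset (Fin n)} {i : Fin n} (hi : i ∉ S) (A : Finset (Fin n)) :
    (insert i S ∩ A).card = (S ∩ A).card + if i ∈ A then 1 else 0 := by
  by_cases h : i ∈ A
  · rw [Finset.insert_inter_of_mem h, Finset.card_insert_of_notMem (by simp [hi]), if_pos h]
  · rw [Finset.insert_inter_of_notMem h, if_neg h, add_zero]

lemma restrictedHAB_monotone {M A B : Finset (Fin n)} (hA : A ⊆ M) (hB : B ⊆ M)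
    (h : A ∩ B = ∅) : Monotone (restrictedHAB M A B) := by
  rw [Finset.monotone_iff_forall_le_insert]
  intro S i hi
  have hAB : ¬ (i ∈ A ∧ i ∈ B) := fun hi' => by
    have := Finset.mem_inter.2 hi'
    rw [h] at this
    exact Finset.notMem_empty _ this
  simp only [restrictedHAB, card_insert_inter hi, pow_add]
  have e1 := neg_one_pow_eq_or ℤ (S ∩ A).card
  have e2 := neg_one_pow_eq_or ℤ (S ∩ B).card
  by_cases iA : i ∈ A
  · have iB : i ∉ B := fun iB => hAB ⟨iA, iB⟩
    have iM := hA iA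
    simp only [iA, iB, iM, if_true, if_false]
    push_cast
    rcases e1 with e1 | e1 <;> rw [e1] <;> simp <;> linarith
  · by_cases iB : i ∈ B
    · have iM := hB iB
      simp only [iA, iB, iM, if_true, if_false]
      push_cast
      rcases e2 with e2 | e2 <;> rw [e2] <;> simp <;> linarith
    · simp only [iA, iB, if_false]
      push_cast
      split_ifs <;> simp

/-- The violated edges in a single direction `i` are disjoint, and `g` must differ from `f` at an
endpoint of each. Erasing `i` from the chosen endpoint recovers the edge, so the choice is
injective. -/
lemma card_le_hammingDist {R : Type*} [LinearOrder R] {f g : Finset (Fin n) → R} (hg : Monotone g)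
    (i : Fin n) {V : Finset (Finset (Fin n))} (hV : ∀ S ∈ V, i ∉ S ∧ f (insert i S) < f S) :
    V.card ≤ hammingDist f g := by
  unfold hammingDist
  refine Finset.card_le_card_of_injOn (fun S => if f S ≠ g S then S else insert i S) ?_ ?_
  · intro S hS
    simp only [Finset.coe_filter, Finset.mem_univ, true_and, Set.mem_ofPred_eq]
    split_ifs with h
    · exact h
    · intro h'
      push Not at h
      have h1 := (hV S hS).2
      rw [h, h'] at h1
      exact absurd (hg (Finset.subset_insert i S)) h1.not_ge
  · intro S hS S' hS' h
    have h1 := (hV S hS).1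
    have h2 := (hV S' hS').1
    have h3 : ∀ S ∈ V, (if f S ≠ g S then S else insert i S).erase i = S := by
      intro S hS
      split_ifs
      · exact Finset.erase_eq_of_notMem (hV S hS).1
      · exact Finset.erase_insert (hV S hS).1
    rw [← h3 S hS, ← h3 S' hS']
    exact congrArg (fun S => Finset.erase S i) h

lemma neg_one_pow_card_inter (S A : Finset (Fin n)) :
    (-1 : ℤ) ^ (S ∩ A).card = ∏ j ∈ S, if j ∈ A then -1 else 1 := by
  rw [Finset.prod_ite, Finset.filter_mem_eq_inter]
  simp

/-- At least a quarter of the sets that avoid `i` meet both `A` and `B` in an even number of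
elements. -/
lemma card_even_even_ge (i : Fin n) (A B : Finset (Fin n)) :
    2 ^ n ≤ 8 * (Finset.univ.filter fun S : Finset (Fin n) =>
      i ∉ S ∧ Even (S ∩ A).card ∧ Even (S ∩ B).card).card := by
  set U := (Finset.univ : Finset (Fin n)).erase i with hU
  have hcardU : U.card + 1 = n := by
    rw [hU, Finset.card_erase_add_one (Finset.mem_univ i), Finset.card_univ, Fintype.card_fin]
  have hset : (Finset.univ.filter fun S : Finset (Fin n) =>
      i ∉ S ∧ Even (S ∩ A).card ∧ Even (S ∩ B).card) =
      U.powerset.filter fun S => Even (S ∩ A).card ∧ Even (S ∩ B).card := by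
    ext S
    simp [hU, Finset.subset_erase]
  -- A character sum over a subcube factors into terms `1 + x j`, each 0 or 2. Hence, in the
  -- expansion of the indicator of the two parity conditions, all nontrivial terms are nonnegative.
  have hpos : ∀ x : Fin n → ℤ, (∀ j, x j = 1 ∨ x j = -1) →
      0 ≤ ∑ S ∈ U.powerset, ∏ j ∈ S, x j := by
    intro x hx
    rw [← Finset.prod_one_add]
    refine Finset.prod_nonneg fun j _ => ?_
    rcases hx j with h | h <;> rw [h] <;> norm_num
  have hA := hpos (fun j => if j ∈ A then -1 else 1) fun j => by by_cases h : j ∈ A <;> simp [h]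
  have hB := hpos (fun j => if j ∈ B then -1 else 1) fun j => by by_cases h : j ∈ B <;> simp [h]
  have hAB := hpos (fun j => (if j ∈ A then -1 else 1) * if j ∈ B then -1 else 1) fun j => by
    by_cases h : j ∈ A <;> by_cases h' : j ∈ B <;> simp [h, h']
  simp only [Finset.prod_mul_distrib, ← neg_one_pow_card_inter] at hA hB hAB
  have hcount : 4 * ((U.powerset.filter fun S =>
      Even (S ∩ A).card ∧ Even (S ∩ B).card).card : ℤ) =
      ∑ S ∈ U.powerset, (1 + (-1 : ℤ) ^ (S ∩ A).card) * (1 + (-1 : ℤ) ^ (S ∩ B).card) := by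
    rw [Finset.card_filter]
    push_cast
    rw [Finset.mul_sum]
    refine Finset.sum_congr rfl fun S _ => ?_
    rcases Nat.even_or_odd (S ∩ A).card with h | h <;>
      rcases Nat.even_or_odd (S ∩ B).card with h' | h' <;>
      simp [h, h', h.neg_one_pow, h'.neg_one_pow, Nat.not_even_iff_odd.2, one_add_one_eq_two]
  have hexpand : ∑ S ∈ U.powerset, (1 + (-1 : ℤ) ^ (S ∩ A).card) * (1 + (-1 : ℤ) ^ (S ∩ B).card) =
      2 ^ U.card + ∑ S ∈ U.powerset, (-1 : ℤ) ^ (S ∩ A).card +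
        ∑ S ∈ U.powerset, (-1 : ℤ) ^ (S ∩ B).card +
        ∑ S ∈ U.powerset, (-1 : ℤ) ^ (S ∩ A).card * (-1 : ℤ) ^ (S ∩ B).card := by
    have : (2 : ℤ) ^ U.card = ∑ S ∈ U.powerset, 1 := by simp
    rw [this, ← Finset.sum_add_distrib, ← Finset.sum_add_distrib, ← Finset.sum_add_distrib]
    exact Finset.sum_congr rfl fun S _ => by ring
  rw [hset]
  zify
  have hpow : (2 : ℤ) ^ n = 2 ^ U.card * 2 := by rw [← pow_succ, hcardU]
  linarith

/-- At the common element `i`, when both parities are even, adding `i` changes the value by `2 - 2 -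
2 = -2`. By `card_even_even_ge` this happens on at least `2 ^ n / 8` edges in direction `i`. -/
lemma isFar_comp_restrictedHAB {R : Type*} [LinearOrder R] {M A B : Finset (Fin n)} (hA : A ⊆ M)
    (h : (A ∩ B).card = 1) {φ : ℤ → R}
    (hφ : StrictMonoOn φ {z | ∃ S, restrictedHAB M A B S = z}) :
    IsFar (1 / 8) (monotoneProperty n R) fun S => φ (restrictedHAB M A B S) := by
  obtain ⟨i, hi⟩ := Finset.card_eq_one.1 h
  have hi : i ∈ A ∩ B := hi ▸ Finset.mem_singleton_self i
  obtain ⟨iA, iB⟩ := Finset.mem_inter.1 hi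
  intro g hg
  have h1 := card_le_hammingDist (f := fun S => φ (restrictedHAB M A B S)) hg i
    (V := Finset.univ.filter fun S : Finset (Fin n) =>
      i ∉ S ∧ Even (S ∩ A).card ∧ Even (S ∩ B).card) fun S hS => by
    obtain ⟨hiS, eA, eB⟩ := (Finset.mem_filter.1 hS).2
    refine ⟨hiS, hφ ⟨_, rfl⟩ ⟨_, rfl⟩ ?_⟩
    simp only [restrictedHAB, card_insert_inter hiS, iA, iB, hA iA, if_true, pow_succ,
      eA.neg_one_pow, eB.neg_one_pow]
    push_cast
    linarith
  have h2 := card_even_even_ge i A B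
  rw [Fintype.card_finset, Fintype.card_fin]
  have h3 : 2 ^ n ≤ 8 * hammingDist (fun S => φ (restrictedHAB M A B S)) g := by omega
  have h4 : ((2 ^ n : ℕ) : ℝ) ≤
      ((8 * hammingDist (fun S => φ (restrictedHAB M A B S)) g : ℕ) : ℝ) := by
    exact_mod_cast h3
  push_cast at h4 ⊢
  linarith

end Functions

/-! ### Simulating a query algorithm by a two-party protocol. -/

section Simulation

variable {n : ℕ} {R X Y : Type*}

/-- The sign that encodes a parity bit. -/
def paritySign (b : Bool) : ℤ := if b then 1 else -1

/-- The protocol in which Alice and Bob, who hold the sets `α x` and `β y`, simulate a query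
algorithm on the function `φ ∘ restrictedHAB M (α x) (β y)`, by exchanging the parities of the
intersections of each queried set with `α x` and `β y`. -/
def simulation (φ : ℤ → R) (M : Finset (Fin n)) (α : X → Finset (Fin n)) (β : Y → Finset (Fin n)) :
    QueryAlg (Finset (Fin n)) R → Protocol X Y
  | .declare b => .output b
  | .query S next =>
    .alice (fun x => decide (Even (S ∩ α x).card)) fun a =>
      .bob (fun y => decide (Even (S ∩ β y).card)) fun b =>
        simulation φ M α β
          (next (φ (2 * ((S ∩ M).card : ℤ) + paritySign a + paritySign b)))

lemma paritySign_decide_even (k : ℕ) : paritySign (decide (Even k)) = (-1) ^ k := by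
  rcases Nat.even_or_odd k with h | h
  · simp [paritySign, h]
  · simp [paritySign, Nat.not_even_iff_odd.2 h, h.neg_one_pow]

lemma simulation_run (φ : ℤ → R) (M : Finset (Fin n)) (α : X → Finset (Fin n))
    (β : Y → Finset (Fin n)) (T : QueryAlg (Finset (Fin n)) R) (x : X) (y : Y) :
    (simulation φ M α β T).run x y = T.verdict fun S => φ (restrictedHAB M (α x) (β y) S) := by
  induction T with
  | declare b => rfl
  | query S next ih =>
    simp only [simulation, Protocol.run, QueryAlg.verdict, paritySign_decide_even]
    exact ih _

lemma simulation_cost (φ : ℤ → R) (M : Finset (Fin n)) (α : X → Finset (Fin n))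
    (β : Y → Finset (Fin n)) (T : QueryAlg (Finset (Fin n)) R) (x : X) (y : Y) :
    (simulation φ M α β T).cost x y =
      2 * T.numQueries fun S => φ (restrictedHAB M (α x) (β y) S) := by
  induction T with
  | declare b => rfl
  | query S next ih =>
    simp only [simulation, Protocol.cost, QueryAlg.numQueries, paritySign_decide_even, ih, mul_add]
    rfl

/-- A monotonicity tester on the cube of dimension `n` yields a protocol for unique-disjointness on
`m ≤ n` elements. -/
theorem exists_protocol_of_tester [LinearOrder R] {m : ℕ} (e : Fin m ↪ Fin n) {φ : ℤ → R}
    (hφ : StrictMonoOn φ {z | ∃ A B S : Finset (Fin n), A ⊆ Finset.univ.map e ∧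
      B ⊆ Finset.univ.map e ∧ restrictedHAB (Finset.univ.map e) A B S = z})
    {Ω : Type*} [MeasurableSpace Ω] {μ : Measure Ω} {T : Ω → QueryAlg (Finset (Fin n)) R} {δ : ℝ}
    {q : ℕ} (hT : IsTester (1 / 8) δ (monotoneProperty n R) μ T) (hq : MakesAtMost T q) :
    ∃ Pr : Ω → Protocol (Finset (Fin m)) (Finset (Fin m)),
      SolvesUniqueDisjointness δ μ Pr ∧ CostAtMost Pr (2 * q) := by
  have hsub : ∀ A : Finset (Fin m), A.map e ⊆ Finset.univ.map e := fun A =>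
    Finset.map_subset_map.2 (Finset.subset_univ A)
  refine ⟨fun ω => simulation φ (Finset.univ.map e) (fun A => A.map e) (fun B => B.map e) (T ω),
    ⟨fun A B => ?_, fun A B h => ?_, fun A B h => ?_⟩, fun A B ω => ?_⟩
  · simp only [simulation_run]
    exact hT.measurableSet_accept _
  · simp only [simulation_run]
    refine hT.error_of_mem _ fun S S' hS => ?_
    refine hφ.monotoneOn ⟨_, _, _, hsub A, hsub B, rfl⟩ ⟨_, _, _, hsub A, hsub B, rfl⟩ ?_
    exact restrictedHAB_monotone (hsub A) (hsub B) (by rw [← Finset.map_inter, h]; simp) hS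
  · simp only [simulation_run]
    refine hT.error_of_far _ (isFar_comp_restrictedHAB (hsub A) ?_ (hφ.mono ?_))
    · rw [← Finset.map_inter, Finset.card_map, h]
    · rintro z ⟨S, rfl⟩
      exact ⟨_, _, S, hsub A, hsub B, rfl⟩
  · rw [simulation_cost]
    exact Nat.mul_le_mul_left 2 (hq _ ω)

end Simulation

/-! ### Small ranges and the trivial query bound. -/

section QueryLowerBound

variable {n : ℕ} {R : Type*} [LinearOrder R]

/-- A large enough range contains a strictly increasing copy of the values of `restrictedHAB`. -/
lemma exists_strictMonoOn_values {m : ℕ} (e : Fin m ↪ Fin n) {s : Finset R}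
    (hs : m + 3 ≤ s.card) : ∃ φ : ℤ → R,
      StrictMonoOn φ {z | ∃ A B S : Finset (Fin n), A ⊆ Finset.univ.map e ∧
        B ⊆ Finset.univ.map e ∧ restrictedHAB (Finset.univ.map e) A B S = z} := by
  let o := s.orderEmbOfFin rfl
  -- The values are even numbers from `-2` to `2m + 2`, so `(z + 2) / 2` indexes them by `0, ..., m
  -- + 2`; the truncations only make the index total.
  refine ⟨fun z => o ⟨min ((z + 2) / 2).toNat (m + 2), by omega⟩, ?_⟩
  have key : ∀ z ∈ {z | ∃ A B S : Finset (Fin n), A ⊆ Finset.univ.map e ∧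
      B ⊆ Finset.univ.map e ∧ restrictedHAB (Finset.univ.map e) A B S = z},
      ∃ k : ℕ, k ≤ m + 2 ∧ z + 2 = 2 * k := by
    rintro z ⟨A, B, S, -, -, rfl⟩
    have hc : (S ∩ Finset.univ.map e).card ≤ m := by
      refine (Finset.card_le_card Finset.inter_subset_right).trans_eq ?_
      simp
    unfold restrictedHAB
    rcases neg_one_pow_eq_or ℤ (S ∩ A).card with h1 | h1 <;>
      rcases neg_one_pow_eq_or ℤ (S ∩ B).card with h2 | h2 <;> rw [h1, h2]
    · exact ⟨(S ∩ Finset.univ.map e).card + 2, by omega, by push_cast; ring⟩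
    · exact ⟨(S ∩ Finset.univ.map e).card + 1, by omega, by push_cast; ring⟩
    · exact ⟨(S ∩ Finset.univ.map e).card + 1, by omega, by push_cast; ring⟩
    · exact ⟨(S ∩ Finset.univ.map e).card, by omega, by ring⟩
  intro z hz z' hz' hlt
  obtain ⟨k, hk, ek⟩ := key z hz
  obtain ⟨k', hk', ek'⟩ := key z' hz'
  apply o.strictMono
  rw [Fin.mk_lt_mk]
  omega

/-- Testing monotonicity on a cube of positive dimension requires at least one query. -/
lemma one_le_of_tester [Nontrivial R] (hn : 0 < n) {Ω : Type*} [MeasurableSpace Ω] {μ : Measure Ω}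
    [IsProbabilityMeasure μ] {T : Ω → QueryAlg (Finset (Fin n)) R} {q : ℕ}
    (hT : IsTester (1 / 8) (1 / 3) (monotoneProperty n R) μ T) (hq : MakesAtMost T q) : 1 ≤ q := by
  by_contra! hq0
  obtain ⟨a, b, hab⟩ := exists_pair_lt R
  let i : Fin n := ⟨0, hn⟩
  have hindep : ∀ (ω : Ω) (f g : Finset (Fin n) → R), (T ω).verdict f = (T ω).verdict g := by
    intro ω f g
    have h := hq f ω
    cases hTω : T ω with
    | declare c => rfl
    | query x next =>
      rw [hTω] at h
      simp only [QueryAlg.numQueries] at h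
      omega
  have hfar : IsFar (1 / 8) (monotoneProperty n R) fun S : Finset (Fin n) =>
      if i ∈ S then a else b := by
    intro g hg
    have h1 := card_le_hammingDist (f := fun S : Finset (Fin n) => if i ∈ S then a else b) hg i
      -- With both sets empty the parity conditions hold trivially, so `card_even_even_ge` can be
      -- reused.
      (V := Finset.univ.filter fun S : Finset (Fin n) =>
        i ∉ S ∧ Even (S ∩ ∅).card ∧ Even (S ∩ ∅).card) fun S hS => by
      have hiS := (Finset.mem_filter.1 hS).2.1
      exact ⟨hiS, by simpa [hiS] using hab⟩
    have h2 := card_even_even_ge i ∅ ∅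
    rw [Fintype.card_finset, Fintype.card_fin]
    have h3 : ((2 ^ n : ℕ) : ℝ) ≤ ((8 * hammingDist
        (fun S : Finset (Fin n) => if i ∈ S then a else b) g : ℕ) : ℝ) := by
      exact_mod_cast (by omega)
    push_cast at h3 ⊢
    linarith
  have e1 := hT.error_of_mem (fun _ => a) monotone_const
  have e2 := hT.error_of_far _ hfar
  simp only [hindep _ (fun S : Finset (Fin n) => if i ∈ S then a else b) fun _ => a] at e2
  have e3 : {ω | (T ω).verdict (fun _ => a) = false} =
      {ω | (T ω).verdict (fun _ => a) = true}ᶜ := by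
    ext ω; simp
  rw [e3, probReal_compl_eq_one_sub (hT.measurableSet_accept _)] at e1
  linarith

end QueryLowerBound

/-! ### The main theorem. -/

theorem theorem8p3 :
    -- every monotonicity tester over a range of size `Ω(n)` makes `Ω(n)` queries
    (∀ κ : ℝ, 0 < κ → ∃ c : ℝ, 0 < c ∧
      ∀ (n : ℕ) (R : Type*) [LinearOrder R] [Nontrivial R],
        (∃ s : Finset R, κ * (n : ℝ) ≤ (s.card : ℝ)) →
      ∀ (Ω : Type*) [MeasurableSpace Ω] (μ : Measure Ω) [IsProbabilityMeasure μ]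
        (T : Ω → QueryAlg (Finset (Fin n)) R) (q : ℕ),
        IsTester (1 / 8) (1 / 3) (monotoneProperty n R) μ T → MakesAtMost T q →
          c * (n : ℝ) ≤ (q : ℝ)) ∧
    -- the functions `h_{AB}` are monotone if `A ∩ B = ∅` and far from monotone if `|A ∩ B| = 1`
    (∀ (n : ℕ) (A B : Finset (Fin n)),
      (A ∩ B = ∅ → hAB A B ∈ monotoneProperty n ℤ) ∧
      ((A ∩ B).card = 1 → IsFar (1 / 8) (monotoneProperty n ℤ) (hAB A B))) ∧
    -- a tester with `q` queries gives a protocol for unique-disjointness with `2q` bits and the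
    -- same error, as soon as the values of the functions `h_{AB}` embed into the range
    (∀ (n : ℕ) (R : Type*) [LinearOrder R] (φ : ℤ → R),
        StrictMonoOn φ {z | ∃ A B S : Finset (Fin n), hAB A B S = z} →
      ∀ (Ω : Type*) [MeasurableSpace Ω] (μ : Measure Ω) [IsProbabilityMeasure μ]
        (T : Ω → QueryAlg (Finset (Fin n)) R) (δ : ℝ) (q : ℕ),
        IsTester (1 / 8) δ (monotoneProperty n R) μ T → MakesAtMost T q →
          ∃ Pr : Ω → Protocol (Finset (Fin n)) (Finset (Fin n)),
            SolvesUniqueDisjointness δ μ Pr ∧ CostAtMost Pr (2 * q)) := by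
  refine ⟨fun κ hκ => ?_, fun n A B => ⟨fun h => ?_, fun h => ?_⟩, ?_⟩
  · set r := unbalancedRate / 10 with hr
    have hr0 : 0 < r := by have := unbalancedRate_pos; positivity
    have hlog2 : 0 < Real.log 2 := Real.log_pos (by norm_num)
    have hlog : 0 < Real.log (243 / 2) := Real.log_pos (by norm_num)
    -- Capping at 1 ensures `κ' * n ≤ n`, so that `m = min n (s.card - 3)` satisfies `κ' * n - 3 ≤
    -- m`.
    set κ' := min κ 1 with hκ'
    have hκ0 : 0 < κ' := lt_min hκ one_pos
    -- The bound on `q` has an additive loss `3 * r + log (243 / 2)`; since `q ≥ 1` for `n > 0`, it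
    -- is absorbed into the coefficient of `q`.
    set C := 10 * Real.log 2 + (3 * r + Real.log (243 / 2)) with hC
    have hC0 : 0 < C := by positivity
    refine ⟨r * κ' / C, by positivity, ?_⟩
    intro n R _ _ ⟨s, hs⟩ Ω _ μ _ T q hT hq
    rcases Nat.eq_zero_or_pos n with rfl | hn
    · simp
    have hq1 : (1 : ℝ) ≤ q := by exact_mod_cast one_le_of_tester hn hT hq
    have hmain : r * (κ' * n - 3) - Real.log (243 / 2) ≤ 10 * Real.log 2 * q := by
      by_cases hs3 : 3 ≤ s.card
      · obtain ⟨m, hmn, hms, hm⟩ : ∃ m : ℕ, m ≤ n ∧ m + 3 ≤ s.card ∧ κ' * n - 3 ≤ m := by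
          refine ⟨min n (s.card - 3), min_le_left _ _, by omega, ?_⟩
          have h1 : κ' * n ≤ n := mul_le_of_le_one_left (Nat.cast_nonneg n) (min_le_right _ _)
          have h2 : κ' * n ≤ s.card :=
            (mul_le_mul_of_nonneg_right (min_le_left _ _) (Nat.cast_nonneg n)).trans hs
          rw [Nat.cast_min, Nat.cast_sub hs3]
          push_cast
          exact le_min (by linarith) (by linarith)
        obtain ⟨φ, hφ⟩ := exists_strictMonoOn_values (Fin.castLEEmb hmn) hms
        obtain ⟨Pr, hPr, hcost⟩ := exists_protocol_of_tester _ hφ hT hq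
        have h := uniqueDisjointness_cost_ge hPr hcost
        rw [← hr] at h
        push_cast at h
        have := mul_le_mul_of_nonneg_left hm hr0.le
        linarith
      · have h1 : κ' * n ≤ s.card :=
          (mul_le_mul_of_nonneg_right (min_le_left _ _) (Nat.cast_nonneg n)).trans hs
        have h2 : (s.card : ℝ) ≤ 3 := by exact_mod_cast (by omega)
        have h3 : r * (κ' * n - 3) ≤ 0 :=
          mul_nonpos_of_nonneg_of_nonpos hr0.le (by linarith)
        have h4 : 0 ≤ 10 * Real.log 2 * q := by positivity
        linarith
    rw [div_mul_eq_mul_div, div_le_iff₀ hC0, hC]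
    have : 3 * r + Real.log (243 / 2) ≤ (3 * r + Real.log (243 / 2)) * q :=
      le_mul_of_one_le_right (by positivity) hq1
    linarith
  · rw [← restrictedHAB_univ]
    exact restrictedHAB_monotone (Finset.subset_univ A) (Finset.subset_univ B) h
  · rw [← restrictedHAB_univ]
    exact isFar_comp_restrictedHAB (φ := id) (Finset.subset_univ A) h
      (strictMono_id.strictMonoOn _)
  · intro n R _ φ hφ Ω _ μ _ T δ q hT hq
    refine exists_protocol_of_tester (Function.Embedding.refl _) (hφ.mono ?_) hT hq
    rintro z ⟨A, B, S, -, -, rfl⟩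
    exact ⟨A, B, S, by rw [Finset.map_refl, restrictedHAB_univ]⟩
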